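/- Let $\mathbb{N}=\{0,1,2,\dots\}$; a square means a number $n^2$ with $n\in\mathbb{N}$. (1) Every integer $m\ge 3.74\times10^{9}$ with $16\nmid m$ can be written as $m=x^2+y^2+z^2+t^2$ with $x,y,z,t\in\mathbb{N}$ and $x+2y+3z+5t$ a square. (2) Every integer $m\ge 7.67\times10^{9}$ with $16\nmid m$ can be written as $m=x^2+y^2+z^2+t^2$ with $x,y,z,t\in\mathbb{N}$ and $2x+3y+4z$ a square. Consequently, two conjectures of Z.-W. Sun reduce to finite checks: (3) Sun's conjecture that every $m\in\mathbb{N}$ not of the form $7\times4^{2k+1}$ $(k\in\mathbb{N})$ can be written as $m=x^2+y^2+z^2+t^2$ with $x,y,z,t\in\mathbb{N}$ and $x+2y+3z+5t$ a square holds in full if it holds for all such $m$ with $0<m<3.74\times10^{9}$. (4) Sun's conjecture that every $m\in\mathbb{N}$ not of the form $3\times2^{4k+1}$ $(k\in\mathbb{N})$ can be written as $m=x^2+y^2+z^2+t^2$ with $x,y,z,t\in\mathbb{N}$ and $2x+3y+4z$ a square holds in full if it holds for all such $m$ with $0<m<7.67\times10^{9}$. -/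

import Mathlib

/-- `m` is a sum `x² + y² + z² + t²` of four squares of natural numbers
such that `a x + b y + c z + d t` is a perfect square. -/
def IsRestrictedSum (a b c d m : ℕ) : Prop :=
  ∃ x y z t : ℕ, m = x ^ 2 + y ^ 2 + z ^ 2 + t ^ 2 ∧ IsSquare (a * x + b * y + c * z + d * t)

/-! Take e = n² with 38m ≤ n⁴ ≤ 39m. If 39m - n⁴ = a² + b² + c², the quaternion e + ai + bj + ck has
norm 39m. Once it is divisible by a quaternion of norm 39 = 1² + 2² + 3² + 5², the components of the
quotient are, up to sign, integers x, y, z, t with x² + y² + z² + t² = m and x + 2y + 3z + 5t = e.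
Divisibility is a congruence condition on (a, b, c), which may be permuted, given signs, or
reflected in a vector (1, ±1, ±1) when 3 divides the inner product; finite checks modulo 39 show
that this freedom suffices.

A negative coordinate would make e smaller than the sum of the other three terms, whose square is at
most 38m by Cauchy–Schwarz. The form 2x + 3y + 4z is treated alike, with 29 = 2² + 3² + 4² and n⁴ ≥
25m.

Legendre's three-square theorem supplies a, b, c for n in suitable residue classes, and large m
leaves room for such an n. Multiples of 16 are handled by scaling all variables by 4. -/

/-! ### The three-square theorem -/

/-- An integral positive definite ternary quadratic form of determinant one takes only values
which are sums of three squares. -/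
theorem ternary_form_sum_three_squares (a B : ℕ) : ∀ b c p q r : ℤ, 0 < a → 0 < B →
    (B : ℤ) = a * b - r ^ 2 →
    a * b * c + 2 * p * q * r - a * p ^ 2 - b * q ^ 2 - c * r ^ 2 = 1 →
    ∀ x y z : ℤ, ∃ u v w : ℤ,
      a * x ^ 2 + b * y ^ 2 + c * z ^ 2 + 2 * p * (y * z) + 2 * q * (x * z) + 2 * r * (x * y)
        = u ^ 2 + v ^ 2 + w ^ 2 := by
  induction a using Nat.strong_induction_on generalizing B with
  | _ a iha =>
  induction B using Nat.strong_induction_on with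
  | _ B ihB =>
  intro b c p q r ha hB hBr hdet x y z
  have ha' : (0 : ℤ) < a := by exact_mod_cast ha
  have hB' : (0 : ℤ) < B := by exact_mod_cast hB
  have reduce : ∀ s t : ℤ, 0 < t → ∃ k : ℤ, |2 * (s + k * t)| ≤ t := by
    intro s t ht
    refine ⟨-((2 * s + t) / (2 * t)), ?_⟩
    have h1 := Int.emod_add_mul_ediv (2 * s + t) (2 * t)
    have h2 := Int.emod_nonneg (2 * s + t) (by omega : 2 * t ≠ 0)
    have h3 := Int.emod_lt_of_pos (2 * s + t) (by omega : 0 < 2 * t)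
    rw [abs_le]
    constructor <;> nlinarith
  -- make `|2 r| ≤ a`
  wlog hr : |2 * r| ≤ a generalizing b c p q r x y z
  · obtain ⟨k, hk⟩ := reduce r a ha'
    obtain ⟨u, v, w, h⟩ := this (b + 2 * k * r + k ^ 2 * a) c (p + k * q) q (r + k * a)
      (by rw [hBr]; ring) (by rw [← hdet]; ring) (x - k * y) y z hk
    exact ⟨u, v, w, by rw [← h]; ring⟩
  by_cases hba : b < a
  · have hb : 0 < b := by
      by_contra hb
      nlinarith [sq_nonneg r]
    lift b to ℕ using hb.le
    obtain ⟨u, v, w, h⟩ := iha b (by exact_mod_cast hba) B a c q p r (by exact_mod_cast hb) hB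
      (by rw [hBr]; ring) (by rw [← hdet]; ring) y x z
    exact ⟨u, v, w, by rw [← h]; ring⟩
  -- make `|2 (a p - r q)| ≤ B`
  wlog hP : |2 * (a * p - r * q)| ≤ B generalizing c p q x y z
  · obtain ⟨k, hk⟩ := reduce (a * p - r * q) B hB'
    obtain ⟨u, v, w, h⟩ := this (c + 2 * k * p + k ^ 2 * b) (p + k * b) (q + k * r)
      (by rw [← hdet]; ring) x (y - k * z) z
      (by convert hk using 3; rw [hBr]; ring)
    exact ⟨u, v, w, by rw [← h]; ring⟩
  -- A 2 × 2 minor of the adjoint matrix equals `a` times the determinant, so the adjoint form can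
  -- be reduced in the same way as the leading binary form.
  have hG : (B : ℤ) * (a * c - q ^ 2) - (a * p - r * q) ^ 2 = a := by
    rw [hBr]; linear_combination (a : ℤ) * hdet
  have hC : 0 < a * c - q ^ 2 := by
    by_contra hC
    nlinarith [sq_nonneg (a * p - r * q)]
  by_cases hCB : a * c - q ^ 2 < B
  · obtain ⟨C, hCe⟩ := Int.eq_ofNat_of_zero_le hC.le
    obtain ⟨u, v, w, h⟩ := ihB C (by omega) c b p r q ha (by omega) (by rw [← hCe])
      (by rw [← hdet]; ring) x z y
    exact ⟨u, v, w, by rw [← h]; ring⟩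
  have hP2 : 4 * (a * p - r * q) ^ 2 ≤ (B : ℤ) ^ 2 := by
    have := sq_le_sq' (abs_le.1 hP).1 (abs_le.1 hP).2
    linarith
  have hr2 : 4 * r ^ 2 ≤ (a : ℤ) ^ 2 := by
    have := sq_le_sq' (abs_le.1 hr).1 (abs_le.1 hr).2
    linarith
  -- B² ≤ B(ac - q²) = a + (ap - rq)² ≤ a + B²/4, and likewise a² ≤ ab = B + r² ≤ B + a²/4; together
  -- these force a = B = 1.
  have h1 : 3 * (B : ℤ) ^ 2 ≤ 4 * a := by nlinarith
  have h2 : 3 * (a : ℤ) ^ 2 ≤ 4 * B := by nlinarith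
  have ha1 : (a : ℤ) = 1 := by
    have : (a : ℤ) < 2 := by
      by_contra h
      have h3 : 2 ≤ (a : ℤ) := by omega
      have h4 : (a : ℤ) < B := by nlinarith
      nlinarith
    omega
  have hB1 : (B : ℤ) = 1 := by nlinarith
  rw [ha1] at hr hP hBr hG ⊢
  rw [hB1] at hP hBr hG
  have hr0 : r = 0 := by rw [abs_le] at hr; omega
  subst hr0
  have hp0 : p = 0 := by rw [abs_le] at hP; omega
  subst hp0
  have hb1 : b = 1 := by linarith
  subst hb1
  exact ⟨x + q * z, y, z, by linear_combination z ^ 2 * hG⟩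

/-- If `-d` is a quadratic residue modulo `d n - 1`, then `n` is a sum of three squares. -/
theorem sum_three_squares_of_neg_residue {n d : ℕ} (hn : 2 ≤ n) (hd : 0 < d)
    (h : ∃ s : ℤ, ((d * n - 1 : ℤ)) ∣ s ^ 2 + d) : ∃ x y z : ℤ, (n : ℤ) = x ^ 2 + y ^ 2 + z ^ 2 := by
  obtain ⟨s, t, ht⟩ := h
  have hd' : (0 : ℤ) < d := by exact_mod_cast hd
  have hn' : (2 : ℤ) ≤ n := by exact_mod_cast hn
  have hpos : (0 : ℤ) < d * n - 1 := by nlinarith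
  have ht0 : 0 < t := by
    by_contra h0
    nlinarith [sq_nonneg s]
  lift t to ℕ using ht0.le
  -- The form with rows (t, s, 1), (s, dn - 1, 0), (1, 0, n) has determinant 1 and takes the value n
  -- at (0, 0, 1).
  obtain ⟨u, v, w, h⟩ := ternary_form_sum_three_squares t d (d * n - 1) n 0 1 s
    (by exact_mod_cast ht0) hd (by linarith) (by linear_combination -(n : ℤ) * ht) 0 0 1
  exact ⟨u, v, w, by rw [← h]; ring⟩
open scoped NumberTheorySymbols in
theorem exists_dvd_sq_add_of_jacobiSym {p d : ℕ} (hp : p.Prime) (h : J(-d | p) = 1) :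
    ∃ s : ℤ, (p : ℤ) ∣ s ^ 2 + d := by
  have := Fact.mk hp
  obtain ⟨s, hs⟩ := ZMod.isSquare_of_jacobiSym_eq_one h
  obtain ⟨s, rfl⟩ := ZMod.intCast_surjective s
  refine ⟨s, (ZMod.intCast_zmod_eq_zero_iff_dvd _ p).1 ?_⟩
  push_cast at hs ⊢
  linear_combination -hs

-- Dirichlet gives a prime p = dn - 1 with d = 4v + 1 and p ≡ 1 mod 4; by reciprocity (-d/p) = (p/d)
-- = (-1/d) = 1.
open scoped NumberTheorySymbols in
theorem sum_three_squares_of_two_mod_four {n : ℕ} (hn : n % 4 = 2) :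
    ∃ x y z : ℤ, (n : ℤ) = x ^ 2 + y ^ 2 + z ^ 2 := by
  have hco : (n - 1).Coprime (4 * n) := by
    have h1 : (n - 1).Coprime n := by
      have := (Nat.coprime_self_add_right (m := n - 1) (n := 1)).2 (Nat.coprime_one_right _)
      rwa [Nat.sub_add_cancel (by omega)] at this
    have h2 : (n - 1).Coprime 4 := by
      have : (n - 1).Coprime (2 ^ 2) := Nat.Coprime.pow_right 2 (Nat.coprime_two_right.2 (by rw [Nat.odd_iff]; omega))
      exact this
    exact h2.mul_right h1
  obtain ⟨p, hpn, hp, hmod⟩ := Nat.forall_exists_prime_gt_and_modEq n (by omega : 4 * n ≠ 0) hco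
  obtain ⟨v, hv⟩ : ∃ v, p = 4 * n * v + (n - 1) := by
    have h1 : (n - 1) % (4 * n) = n - 1 := Nat.mod_eq_of_lt (by omega)
    refine ⟨p / (4 * n), ?_⟩
    have h2 : p % (4 * n) = (n - 1) % (4 * n) := hmod
    have := Nat.div_add_mod p (4 * n)
    omega
  have hpd : (p : ℤ) = ((4 * v + 1 : ℕ) : ℤ) * n - 1 := by
    rw [hv]; push_cast [Nat.cast_sub (by omega : 1 ≤ n)]; ring
  have hp4 : p % 4 = 1 := by
    rw [hv, mul_assoc]; omega
  have hd4 : (4 * v + 1) % 4 = 1 := by omega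
  have hpo : Odd p := by rw [Nat.odd_iff]; omega
  have hdo : Odd (4 * v + 1) := by rw [Nat.odd_iff]; omega
  have hj : J(-((4 * v + 1 : ℕ) : ℤ) | p) = 1 := by
    rw [jacobiSym.neg _ hpo, ZMod.χ₄_nat_one_mod_four hp4, one_mul,
      jacobiSym.quadratic_reciprocity_one_mod_four hd4 hpo,
      jacobiSym.mod_left' (a₂ := -1), jacobiSym.at_neg_one hdo, ZMod.χ₄_nat_one_mod_four hd4]
    rw [hpd, sub_eq_add_neg, Int.mul_add_emod_self_left]
  obtain ⟨s, hs⟩ := exists_dvd_sq_add_of_jacobiSym hp hj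
  exact sum_three_squares_of_neg_residue (d := 4 * v + 1) (by omega) (by omega) ⟨s, hpd ▸ hs⟩

-- Here dn - 1 is even, so Dirichlet is applied to 2p = dn - 1 with d = 8v + c. The choice of c
-- makes (cn - 1)/2 odd, hence coprime to 4n, and 2p ≡ -1 mod d then gives (p/d) = 1.
open scoped NumberTheorySymbols in
theorem sum_three_squares_of_odd {n : ℕ} (hn : n % 8 = 1 ∨ n % 8 = 3 ∨ n % 8 = 5) :
    ∃ x y z : ℤ, (n : ℤ) = x ^ 2 + y ^ 2 + z ^ 2 := by
  rcases (by omega : n = 1 ∨ 2 ≤ n) with rfl | hn2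
  · exact ⟨1, 0, 0, rfl⟩
  obtain ⟨c, hc⟩ : ∃ c, (c = 3 ∧ n % 4 = 1) ∨ (c = 1 ∧ n % 8 = 3) := by
    rcases (by omega : n % 4 = 1 ∨ n % 8 = 3) with h | h
    exacts [⟨3, .inl ⟨rfl, h⟩⟩, ⟨1, .inr ⟨rfl, h⟩⟩]
  obtain ⟨e, he⟩ : ∃ e, c * n = 2 * e + 1 := by
    rcases hc with ⟨rfl, h⟩ | ⟨rfl, h⟩
    exacts [⟨3 * n / 2, by omega⟩, ⟨n / 2, by omega⟩]
  have heo : Odd e := by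
    rw [Nat.odd_iff]
    rcases hc with ⟨rfl, h⟩ | ⟨rfl, h⟩ <;> omega
  have hco : e.Coprime (4 * n) := by
    have h1 : e.Coprime n := by
      have : (2 * e + 1).Coprime e := by simp
      rw [← he] at this
      exact (Nat.Coprime.coprime_mul_left this).symm
    have h2 : e.Coprime (2 ^ 2) := Nat.Coprime.pow_right 2 (Nat.coprime_two_right.2 heo)
    exact Nat.Coprime.mul_right h2 h1
  obtain ⟨p, hpn, hp, hmod⟩ := Nat.forall_exists_prime_gt_and_modEq n (by omega : 4 * n ≠ 0) hco
  obtain ⟨v, hv⟩ : ∃ v, p = 4 * n * v + e := by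
    have h1 : e % (4 * n) = e := Nat.mod_eq_of_lt (by
      rcases hc with ⟨rfl, h⟩ | ⟨rfl, h⟩ <;> omega)
    refine ⟨p / (4 * n), ?_⟩
    have h2 : p % (4 * n) = e % (4 * n) := hmod
    have := Nat.div_add_mod p (4 * n)
    omega
  set d := 8 * v + c with hd
  have hpd : (2 : ℤ) * p = (d : ℤ) * n - 1 := by
    have he' : (c : ℤ) * n = 2 * e + 1 := by exact_mod_cast he
    rw [hv, hd]; push_cast; linear_combination -he'
  have hpo : Odd p := by
    rw [hv, mul_assoc]
    rw [Nat.odd_iff] at *; omega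
  have hdo : Odd d := by
    rw [Nat.odd_iff]; omega
  have h2p : J(2 | d) * J(p | d) = J(-1 | d) := by
    rw [← jacobiSym.mul_left, hpd]
    exact jacobiSym.mod_left' (by simp [sub_eq_add_neg])
  rw [jacobiSym.at_neg_one hdo, jacobiSym.at_two hdo, ZMod.χ₈_nat_eq_if_mod_eight,
    ZMod.χ₄_nat_eq_if_mod_four] at h2p
  have hpJ : J(p | d) = 1 := by
    rcases hc with ⟨rfl, h⟩ | ⟨rfl, h⟩
    · simp [show d % 2 = 1 by omega, show d % 8 = 3 by omega, show d % 4 = 3 by omega] at h2p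
      exact h2p
    · simp [show d % 2 = 1 by omega, show d % 8 = 1 by omega, show d % 4 = 1 by omega] at h2p
      exact h2p
  have hj : J(-(d : ℤ) | p) = 1 := by
    rw [jacobiSym.neg _ hpo]
    rcases (by rw [Nat.odd_iff] at hpo; omega : p % 4 = 1 ∨ p % 4 = 3) with h4 | h4
    · rw [ZMod.χ₄_nat_one_mod_four h4, one_mul,
        jacobiSym.quadratic_reciprocity_one_mod_four' hdo h4, hpJ]
    · have hd4 : d % 4 = 3 := by
        rw [hv, mul_assoc] at h4
        rcases hc with ⟨rfl, h⟩ | ⟨rfl, h⟩ <;> omega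
      rw [ZMod.χ₄_nat_three_mod_four h4,
        jacobiSym.quadratic_reciprocity_three_mod_four hd4 h4, hpJ]
      norm_num
  obtain ⟨s, hs⟩ := exists_dvd_sq_add_of_jacobiSym hp hj
  have hpo' : Odd (p : ℤ) := by exact_mod_cast hpo
  have hdo' : Odd (d : ℤ) := by exact_mod_cast hdo
  refine sum_three_squares_of_neg_residue (d := d) hn2 (by omega) ?_
  rw [← hpd]
  -- Replacing s by s + p if necessary makes the root odd, which gives the missing factor 2.
  have key : ∀ t : ℤ, Odd t → (p : ℤ) ∣ t ^ 2 + d → (2 * p : ℤ) ∣ t ^ 2 + d := by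
    intro t ht h
    refine IsCoprime.mul_dvd (Int.isCoprime_two_left.2 hpo') ?_ h
    exact (ht.pow.add_odd hdo').two_dvd
  rcases Int.even_or_odd s with h | h
  · refine ⟨s + p, key _ (h.add_odd hpo') ?_⟩
    have : (s + p) ^ 2 + (d : ℤ) = (s ^ 2 + d) + p * (2 * s + p) := by ring
    rw [this]
    exact dvd_add hs (dvd_mul_right _ _)
  · exact ⟨s, key s h hs⟩

/-- Legendre's three-square theorem for integers not divisible by four. -/
theorem sum_three_squares {n : ℤ} (h0 : 0 ≤ n) (h4 : n % 4 ≠ 0) (h8 : n % 8 ≠ 7) :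
    ∃ x y z : ℤ, n = x ^ 2 + y ^ 2 + z ^ 2 := by
  lift n to ℕ using h0
  by_cases h : n % 4 = 2
  · exact sum_three_squares_of_two_mod_four h
  · exact sum_three_squares_of_odd (by omega)

theorem exists_int_sign {p : ℕ} {s : ZMod p} (hs : s ∈ [(1 : ZMod p), -1]) :
    ∃ σ : ℤ, σ ^ 2 = 1 ∧ (σ : ZMod p) = s := by
  simp only [List.mem_cons, List.not_mem_nil, or_false] at hs
  rcases hs with rfl | rfl
  · exact ⟨1, by norm_num, by simp⟩
  · exact ⟨-1, by norm_num, by simp⟩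

/-! ### Division by a quaternion of norm 29 -/

/-- Linear conditions under which the quaternion `e + a i + b j + c k` is divisible
by `2 i + 3 j + 4 k` on one side, when its norm is divisible by `29`. -/
def Lin29 {K : Type*} [CommRing K] (e a b c : K) : Prop :=
  2 * a + 3 * b + 4 * c = 0 ∧ 2 * e + 3 * c - 4 * b = 0

instance {K : Type*} [CommRing K] [DecidableEq K] (e a b c : K) : Decidable (Lin29 e a b c) :=
  inferInstanceAs (Decidable (_ ∧ _))

/-- Some signed permutation of `(a, b, c)` satisfies `Lin29`. -/
def Good29 {K : Type*} [CommRing K] (e a b c : K) : Prop :=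
  ∃ s ∈ [(1 : K), -1], ∃ t ∈ [(1 : K), -1], ∃ r ∈ [(1 : K), -1],
    Lin29 e (s * a) (t * b) (r * c) ∨ Lin29 e (s * a) (t * c) (r * b) ∨
    Lin29 e (s * b) (t * a) (r * c) ∨ Lin29 e (s * b) (t * c) (r * a) ∨
    Lin29 e (s * c) (t * a) (r * b) ∨ Lin29 e (s * c) (t * b) (r * a)

instance {K : Type*} [CommRing K] [DecidableEq K] (e a b c : K) : Decidable (Good29 e a b c) := by
  unfold Good29; infer_instance

-- The alternative is the reflection in (1, s, t), since 20 = 2/3 modulo 29. It must work for all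
-- signs, because modulo 3 considerations will dictate which reflection is integral.
set_option maxRecDepth 100000 in
theorem good29_or_good29_reflection : ∀ a b c : ZMod 29, a * a + b * b + c * c = -1 →
    Good29 1 a b c ∨ ∀ s ∈ [(1 : ZMod 29), -1], ∀ t ∈ [(1 : ZMod 29), -1],
      let k := 20 * (a + s * b + t * c)
      Good29 1 (a - k) (b - s * k) (c - t * k) := by decide +kernel

theorem Lin29.scale {K : Type*} [CommRing K] {w e a b c : K} (hw : e * w = 1)
    (h : Lin29 1 (w * a) (w * b) (w * c)) : Lin29 e a b c := by
  obtain ⟨h1, h2⟩ := h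
  constructor
  · linear_combination e * h1 - (2 * a + 3 * b + 4 * c) * hw
  · linear_combination e * h2 - (3 * c - 4 * b) * hw

theorem Good29.scale {K : Type*} [CommRing K] {w e a b c : K} (hw : e * w = 1)
    (h : Good29 1 (w * a) (w * b) (w * c)) : Good29 e a b c := by
  obtain ⟨s, hs, t, ht, r, hr, h⟩ := h
  refine ⟨s, hs, t, ht, r, hr, ?_⟩
  simp only [mul_left_comm _ w] at h
  exact h.imp (.scale hw) <| .imp (.scale hw) <| .imp (.scale hw) <| .imp (.scale hw) <|
    .imp (.scale hw) (.scale hw)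

theorem exists_rep_of_lin29 {e m a b c : ℤ} (h : 29 * m = e ^ 2 + a ^ 2 + b ^ 2 + c ^ 2)
    (hl : Lin29 (e : ZMod 29) a b c) :
    ∃ x y z t : ℤ, m = x ^ 2 + y ^ 2 + z ^ 2 + t ^ 2 ∧ 2 * x + 3 * y + 4 * z = e := by
  obtain ⟨h1, h2⟩ := hl
  have h1' : (29 : ℤ) ∣ 2 * a + 3 * b + 4 * c := by
    rw [← Nat.cast_ofNat, ← ZMod.intCast_zmod_eq_zero_iff_dvd]; push_cast; exact h1
  have h2' : (29 : ℤ) ∣ 2 * e + 3 * c - 4 * b := by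
    rw [← Nat.cast_ofNat, ← ZMod.intCast_zmod_eq_zero_iff_dvd]; push_cast; exact h2
  obtain ⟨t, ht⟩ := h1'
  obtain ⟨x, hx⟩ := h2'
  -- The remaining two components are linear combinations of the first two modulo 29.
  obtain ⟨y, hy⟩ : (29 : ℤ) ∣ 3 * e + 4 * a - 2 * c := by omega
  obtain ⟨z, hz⟩ : (29 : ℤ) ∣ 4 * e + 2 * b - 3 * a := by omega
  refine ⟨x, y, z, t, ?_, by omega⟩
  have h3 : 29 ^ 2 * m = (29 * x) ^ 2 + (29 * y) ^ 2 + (29 * z) ^ 2 + (29 * t) ^ 2 := by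
    rw [← ht, ← hx, ← hy, ← hz]; linear_combination 29 * h
  linarith

theorem exists_rep_of_good29 {e m a b c : ℤ} (h : 29 * m = e ^ 2 + a ^ 2 + b ^ 2 + c ^ 2)
    (hl : Good29 (e : ZMod 29) a b c) :
    ∃ x y z t : ℤ, m = x ^ 2 + y ^ 2 + z ^ 2 + t ^ 2 ∧ 2 * x + 3 * y + 4 * z = e := by
  obtain ⟨s, hs, t, ht, r, hr, hl⟩ := hl
  obtain ⟨s, hs2, rfl⟩ := exists_int_sign hs
  obtain ⟨t, ht2, rfl⟩ := exists_int_sign ht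
  obtain ⟨r, hr2, rfl⟩ := exists_int_sign hr
  have key : ∀ {a b c : ℤ}, 29 * m = e ^ 2 + a ^ 2 + b ^ 2 + c ^ 2 →
      Lin29 (e : ZMod 29) (s * a) (t * b) (r * c) →
      ∃ x y z t : ℤ, m = x ^ 2 + y ^ 2 + z ^ 2 + t ^ 2 ∧ 2 * x + 3 * y + 4 * z = e := by
    intro a b c h hl
    refine exists_rep_of_lin29 (a := s * a) (b := t * b) (c := r * c) ?_ (by push_cast; exact hl)
    rw [mul_pow, mul_pow, mul_pow, hs2, ht2, hr2, h]; ring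
  rcases hl with hl | hl | hl | hl | hl | hl <;> exact key (by linear_combination h) hl

theorem exists_sign_dvd_three {a b c : ℤ} (h : (a ^ 2 + b ^ 2 + c ^ 2) % 3 ≠ 1) :
    ∃ s t : ℤ, (s = 1 ∨ s = -1) ∧ (t = 1 ∨ t = -1) ∧ 3 ∣ a + s * b + t * c := by
  have key : ∀ a b c : ZMod 3, a ^ 2 + b ^ 2 + c ^ 2 ≠ 1 → a + b + c = 0 ∨ a + b - c = 0 ∨
      a - b + c = 0 ∨ a - b - c = 0 := by decide
  have h' : (a : ZMod 3) ^ 2 + (b : ZMod 3) ^ 2 + (c : ZMod 3) ^ 2 ≠ 1 := by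
    intro h'
    have : ((a ^ 2 + b ^ 2 + c ^ 2 : ℤ) : ZMod 3) = (1 : ℤ) := by push_cast; exact h'
    rw [ZMod.intCast_eq_intCast_iff] at this
    exact h this
  have d : ∀ k : ℤ, (k : ZMod 3) = 0 → 3 ∣ k := fun k => (ZMod.intCast_zmod_eq_zero_iff_dvd k 3).1
  rcases key _ _ _ h' with h | h | h | h
  · exact ⟨1, 1, by simp, by simp, d _ (by push_cast; linear_combination h)⟩
  · exact ⟨1, -1, by simp, by simp, d _ (by push_cast; linear_combination h)⟩
  · exact ⟨-1, 1, by simp, by simp, d _ (by push_cast; linear_combination h)⟩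
  · exact ⟨-1, -1, by simp, by simp, d _ (by push_cast; linear_combination h)⟩

theorem exists_rep_two_three_four {e m a b c : ℤ} (he : ¬ 29 ∣ e)
    (h : 29 * m = e ^ 2 + a ^ 2 + b ^ 2 + c ^ 2) (h3 : (a ^ 2 + b ^ 2 + c ^ 2) % 3 ≠ 1) :
    ∃ x y z t : ℤ, m = x ^ 2 + y ^ 2 + z ^ 2 + t ^ 2 ∧ 2 * x + 3 * y + 4 * z = e := by
  have : Fact (Nat.Prime 29) := ⟨by norm_num⟩
  have he0 : (e : ZMod 29) ≠ 0 := fun h0 => he ((ZMod.intCast_zmod_eq_zero_iff_dvd e 29).1 h0)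
  have hw := mul_inv_cancel₀ he0
  set w := (e : ZMod 29)⁻¹
  have h' : (e : ZMod 29) ^ 2 + (a : ZMod 29) ^ 2 + (b : ZMod 29) ^ 2 + (c : ZMod 29) ^ 2 = 0 := by
    have : ((29 * m : ℤ) : ZMod 29) = 0 := (ZMod.intCast_zmod_eq_zero_iff_dvd _ 29).2 ⟨m, rfl⟩
    rw [h] at this
    exact_mod_cast this
  rcases good29_or_good29_reflection (w * a) (w * b) (w * c)
    (by linear_combination w ^ 2 * h' - (e * w + 1) * hw) with hg | hg
  · exact exists_rep_of_good29 h (hg.scale hw)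
  · obtain ⟨s, t, hs, ht, l, hl⟩ := exists_sign_dvd_three h3
    have hs2 : s ^ 2 = 1 := by rcases hs with rfl | rfl <;> norm_num
    have ht2 : t ^ 2 = 1 := by rcases ht with rfl | rfl <;> norm_num
    have hk : 20 * ((a : ZMod 29) + s * b + t * c) = 2 * l := by
      have h29 : (29 : ZMod 29) = 0 := by exact_mod_cast ZMod.natCast_self 29
      have : (a : ZMod 29) + s * b + t * c = 3 * l := by exact_mod_cast congrArg (Int.cast (R := ZMod 29)) hl
      linear_combination 20 * this + 2 * (l : ZMod 29) * h29
    have hg := hg s (by rcases hs with rfl | rfl <;> simp) t (by rcases ht with rfl | rfl <;> simp)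
    refine exists_rep_of_good29 (a := a - 2 * l) (b := b - s * (2 * l)) (c := c - t * (2 * l)) ?_ ?_
    · linear_combination h + 4 * l * hl - 4 * l ^ 2 * hs2 - 4 * l ^ 2 * ht2
    · refine Good29.scale hw ?_
      push_cast
      rw [← hk]
      convert hg using 1 <;> ring

/-! ### Division by a quaternion of norm 39 -/

/-- Linear conditions under which the quaternion `e + a i + b j + c k` is divisible
by `1 - 2 i - 3 j - 5 k` on the side given by the sign `σ`. -/
def Lin39 {K : Type*} [CommRing K] (σ e a b c : K) : Prop :=
  e + 2 * a + 3 * b + 5 * c = 0 ∧ 2 * e - a + σ * (3 * c - 5 * b) = 0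

instance {K : Type*} [CommRing K] [DecidableEq K] (σ e a b c : K) :
    Decidable (Lin39 σ e a b c) :=
  inferInstanceAs (Decidable (_ ∧ _))

/-- Some signed permutation of `(a, b, c)` satisfies `Lin39`. -/
def Good39 {K : Type*} [CommRing K] (e a b c : K) : Prop :=
  ∃ s ∈ [(1 : K), -1], ∃ t ∈ [(1 : K), -1], ∃ r ∈ [(1 : K), -1], ∃ σ ∈ [(1 : K), -1],
    Lin39 σ e (s * a) (t * b) (r * c) ∨ Lin39 σ e (s * a) (t * c) (r * b) ∨
    Lin39 σ e (s * b) (t * a) (r * c) ∨ Lin39 σ e (s * b) (t * c) (r * a) ∨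
    Lin39 σ e (s * c) (t * a) (r * b) ∨ Lin39 σ e (s * c) (t * b) (r * a)

instance {K : Type*} [CommRing K] [DecidableEq K] (e a b c : K) : Decidable (Good39 e a b c) := by
  unfold Good39; infer_instance

/-- Some coordinate squares to `-e²`. -/
def HasRoot {K : Type*} [CommRing K] (e a b c : K) : Prop :=
  a * a = -(e * e) ∨ b * b = -(e * e) ∨ c * c = -(e * e)

instance {K : Type*} [CommRing K] [DecidableEq K] (e a b c : K) : Decidable (HasRoot e a b c) :=
  inferInstanceAs (Decidable (_ ∨ _ ∨ _))

/-- Coefficients `r ≡ a (mod 13)`, `r ≡ b (mod 3)` of `ZMod 39`. -/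
def crt39 (a : ZMod 13) (b : ℤ) : ZMod 39 := 27 * (a.val : ZMod 39) + 13 * b

-- After scaling, e ∈ {0, 1} equals its square. The residues modulo 3 are fixed at (1; 1, 1, 0), so
-- both reflections, in (1, -1, ±1) with 5 = 2/3 modulo 13, are integral. A failing triple has no
-- root, but one of its reflections has.
set_option maxRecDepth 100000 in
theorem good39_or_hasRoot_reflection : ∀ e ∈ [(0 : ZMod 13), 1], ∀ a b c : ZMod 13,
    a * a + b * b + c * c = -e →
    Good39 (crt39 e 1) (crt39 a 1) (crt39 b 1) (crt39 c 0) ∨ ¬ HasRoot e a b c ∧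
      ((let k := 5 * (a - b + c); HasRoot e (a - k) (b + k) (c - k)) ∨
      (let k := 5 * (a - b - c); HasRoot e (a - k) (b + k) (c + k))) := by decide +kernel

theorem Lin39.of_scale {K : Type*} [CommRing K] {w σ e a b c : K} (hw : IsUnit w)
    (h : Lin39 σ (w * e) (w * a) (w * b) (w * c)) : Lin39 σ e a b c := by
  obtain ⟨h1, h2⟩ := h
  constructor <;> apply hw.mul_left_cancel
  · linear_combination h1
  · linear_combination h2

theorem Good39.of_scale {K : Type*} [CommRing K] {w e a b c : K} (hw : IsUnit w)
    (h : Good39 (w * e) (w * a) (w * b) (w * c)) : Good39 e a b c := by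
  obtain ⟨s, hs, t, ht, r, hr, σ, hσ, h⟩ := h
  refine ⟨s, hs, t, ht, r, hr, σ, hσ, ?_⟩
  simp only [mul_left_comm _ w] at h
  exact h.imp (.of_scale hw) <| .imp (.of_scale hw) <| .imp (.of_scale hw) <|
    .imp (.of_scale hw) <| .imp (.of_scale hw) (.of_scale hw)

theorem HasRoot.of_scale {K : Type*} [CommRing K] {w e a b c : K} (hw : IsUnit w)
    (h : HasRoot (w * e) (w * a) (w * b) (w * c)) : HasRoot e a b c := by
  have key : ∀ x : K, (w * x) * (w * x) = -((w * e) * (w * e)) → x * x = -(e * e) := by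
    intro x hx
    apply (hw.mul hw).mul_left_cancel
    linear_combination hx
  exact h.imp (key a) <| .imp (key b) (key c)

theorem HasRoot.scale {K : Type*} [CommRing K] (w : K) {e a b c : K}
    (h : HasRoot e a b c) : HasRoot (w * e) (w * a) (w * b) (w * c) := by
  have key : ∀ x : K, x * x = -(e * e) → (w * x) * (w * x) = -((w * e) * (w * e)) := by
    intro x hx
    linear_combination w * w * hx
  exact h.imp (key a) <| .imp (key b) (key c)

theorem exists_rep_of_lin39 {σ e m a b c : ℤ} (hσ : σ = 1 ∨ σ = -1)
    (h : 39 * m = e ^ 2 + a ^ 2 + b ^ 2 + c ^ 2) (hl : Lin39 (σ : ZMod 39) e a b c) :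
    ∃ x y z t : ℤ, m = x ^ 2 + y ^ 2 + z ^ 2 + t ^ 2 ∧ x + 2 * y + 3 * z + 5 * t = e := by
  obtain ⟨h1, h2⟩ := hl
  have h1' : (39 : ℤ) ∣ e + 2 * a + 3 * b + 5 * c := by
    rw [← Nat.cast_ofNat, ← ZMod.intCast_zmod_eq_zero_iff_dvd]; push_cast; exact h1
  have h2' : (39 : ℤ) ∣ 2 * e - a + σ * (3 * c - 5 * b) := by
    rw [← Nat.cast_ofNat, ← ZMod.intCast_zmod_eq_zero_iff_dvd]; push_cast; exact h2
  obtain ⟨x, hx⟩ := h1'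
  obtain ⟨y, hy⟩ := h2'
  obtain ⟨z, hz⟩ : (39 : ℤ) ∣ 3 * e - b + σ * (5 * a - 2 * c) := by
    rcases hσ with rfl | rfl <;> omega
  obtain ⟨t, ht⟩ : (39 : ℤ) ∣ 5 * e - c + σ * (2 * b - 3 * a) := by
    rcases hσ with rfl | rfl <;> omega
  have hσ2 : σ ^ 2 = 1 := by rcases hσ with rfl | rfl <;> norm_num
  refine ⟨x, y, z, t, ?_, by linarith⟩
  have h3 : 39 ^ 2 * m = (39 * x) ^ 2 + (39 * y) ^ 2 + (39 * z) ^ 2 + (39 * t) ^ 2 := by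
    rw [← ht, ← hx, ← hy, ← hz]
    linear_combination 39 * h -
      ((3 * c - 5 * b) ^ 2 + (5 * a - 2 * c) ^ 2 + (2 * b - 3 * a) ^ 2) * hσ2
  linarith

theorem exists_rep_of_good39 {e m a b c : ℤ} (h : 39 * m = e ^ 2 + a ^ 2 + b ^ 2 + c ^ 2)
    (hl : Good39 (e : ZMod 39) a b c) :
    ∃ x y z t : ℤ, m = x ^ 2 + y ^ 2 + z ^ 2 + t ^ 2 ∧ x + 2 * y + 3 * z + 5 * t = e := by
  obtain ⟨s, hs, t, ht, r, hr, σ, hσ, hl⟩ := hl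
  obtain ⟨s, hs2, rfl⟩ := exists_int_sign hs
  obtain ⟨t, ht2, rfl⟩ := exists_int_sign ht
  obtain ⟨r, hr2, rfl⟩ := exists_int_sign hr
  obtain ⟨σ, hσ2, rfl⟩ := exists_int_sign hσ
  have key : ∀ {a b c : ℤ}, 39 * m = e ^ 2 + a ^ 2 + b ^ 2 + c ^ 2 →
      Lin39 (σ : ZMod 39) e (s * a) (t * b) (r * c) →
      ∃ x y z t : ℤ, m = x ^ 2 + y ^ 2 + z ^ 2 + t ^ 2 ∧ x + 2 * y + 3 * z + 5 * t = e := by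
    intro a b c h hl
    refine exists_rep_of_lin39 (σ := σ) (a := s * a) (b := t * b) (c := r * c)
      (mul_self_eq_one_iff.1 (by rw [← sq, hσ2])) ?_ (by push_cast; exact hl)
    rw [mul_pow, mul_pow, mul_pow, hs2, ht2, hr2, h]; ring
  rcases hl with hl | hl | hl | hl | hl | hl <;> exact key (by linear_combination h) hl

theorem crt39_intCast {x r : ℤ} (h : x % 3 = r % 3) : crt39 (x : ZMod 13) r = (x : ZMod 39) := by
  have hv : (((x : ZMod 13).val : ℕ) : ℤ) = x % 13 := ZMod.val_intCast x
  have : crt39 (x : ZMod 13) r = ((27 * (x % 13) + 13 * r : ℤ) : ZMod 39) := by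
    rw [← hv, crt39]; push_cast; rfl
  rw [this, ZMod.intCast_eq_intCast_iff]
  change _ % (39 : ℤ) = _ % (39 : ℤ)
  omega

/-- A unit modulo `39` that normalises `e` modulo `13`. -/
theorem exists_normalizing_unit {e : ℤ} (he : e % 3 = 1) : ∃ w : ℤ, w % 3 = 1 ∧
    IsUnit (w : ZMod 39) ∧ IsUnit (w : ZMod 13) ∧ ((w * e : ℤ) : ZMod 13) ∈ [(0 : ZMod 13), 1] := by
  by_cases h : (13 : ℤ) ∣ e
  · refine ⟨1, rfl, by simp, by simp, ?_⟩
    rw [one_mul, (ZMod.intCast_zmod_eq_zero_iff_dvd e 13).2 h]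
    simp
  · have h13 : IsCoprime (13 : ℤ) e :=
      (Irreducible.coprime_iff_not_dvd (Int.prime_ofNat_iff.2 (by norm_num)).irreducible).2 h
    have h3 : IsCoprime (3 : ℤ) e := ⟨-(e / 3), 1, by omega⟩
    obtain ⟨v, w, hw⟩ : IsCoprime (39 : ℤ) e := by
      have := h13.mul_left h3
      norm_num at this
      exact this
    have hw13 : (w : ZMod 13) * e = 1 := by
      have : (w * e : ℤ) ≡ 1 [ZMOD 13] := by
        change _ % _ = _ % _
        rw [← hw]; omega
      simpa using (ZMod.intCast_eq_intCast_iff _ _ 13).2 this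
    have hw39 : (w : ZMod 39) * e = 1 := by
      have : (w * e : ℤ) ≡ 1 [ZMOD 39] := by
        change _ % _ = _ % _
        rw [← hw]; omega
      simpa using (ZMod.intCast_eq_intCast_iff _ _ 39).2 this
    refine ⟨w, ?_, .of_mul_eq_one _ hw39, .of_mul_eq_one _ hw13, ?_⟩
    · have h1 : (w * e) % 3 = 1 := by omega
      rw [Int.mul_emod, he] at h1
      omega
    · push_cast; rw [hw13]; simp

theorem exists_rep_of_mod_three {e m a b c : ℤ} (he : e % 3 = 1)
    (h : 39 * m = e ^ 2 + a ^ 2 + b ^ 2 + c ^ 2) (ha : a % 3 = 1) (hb : b % 3 = 1)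
    (hc : c % 3 = 0) :
    (∃ x y z t : ℤ, m = x ^ 2 + y ^ 2 + z ^ 2 + t ^ 2 ∧ x + 2 * y + 3 * z + 5 * t = e) ∨
    ¬ HasRoot (e : ZMod 13) a b c ∧ ∃ k l : ℤ, (l = 1 ∨ l = -1) ∧ 3 * k = a - b + l * c ∧
      HasRoot (e : ZMod 13) (a - 2 * k : ℤ) (b + 2 * k : ℤ) (c - l * (2 * k) : ℤ) := by
  obtain ⟨w, hw3, hw39, hw13, hwe⟩ := exists_normalizing_unit he
  have h' : (e : ZMod 13) ^ 2 + (a : ZMod 13) ^ 2 + (b : ZMod 13) ^ 2 + (c : ZMod 13) ^ 2 = 0 := by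
    have : ((39 * m : ℤ) : ZMod 13) = 0 := (ZMod.intCast_zmod_eq_zero_iff_dvd _ 13).2 ⟨3 * m, by ring⟩
    rw [h] at this
    exact_mod_cast this
  have hwe2 : ((w * e : ℤ) : ZMod 13) ^ 2 = ((w * e : ℤ) : ZMod 13) := by
    simp only [List.mem_cons, List.not_mem_nil, or_false] at hwe
    rcases hwe with hwe | hwe <;> rw [hwe] <;> norm_num
  have h1 := good39_or_hasRoot_reflection _ hwe (w * a : ℤ) (w * b : ℤ) (w * c : ℤ) (by
    push_cast at hwe2 ⊢
    linear_combination (w : ZMod 13) ^ 2 * h' - hwe2)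
  rw [crt39_intCast (by rw [Int.mul_emod, hw3, he]; rfl),
    crt39_intCast (by rw [Int.mul_emod, hw3, ha]; rfl),
    crt39_intCast (by rw [Int.mul_emod, hw3, hb]; rfl),
    crt39_intCast (by rw [Int.mul_emod, hw3, hc]; rfl)] at h1
  push_cast at h1
  have h13 : (13 : ZMod 13) = 0 := by exact_mod_cast ZMod.natCast_self 13
  rcases h1 with h1 | ⟨h0, h1 | h1⟩
  · exact .inl (exists_rep_of_good39 h (h1.of_scale hw39))
  · obtain ⟨k, hk⟩ : (3 : ℤ) ∣ a - b + c := by omega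
    refine .inr ⟨fun hr => h0 (hr.scale _), k, 1, .inl rfl, by omega, .of_scale hw13 ?_⟩
    have hk' : (a : ZMod 13) - b + c = 3 * k := by
      exact_mod_cast congrArg (Int.cast (R := ZMod 13)) hk
    push_cast
    convert h1 using 1
    · linear_combination 5 * (w : ZMod 13) * hk' + (w : ZMod 13) * k * h13
    · linear_combination -5 * (w : ZMod 13) * hk' - (w : ZMod 13) * k * h13
    · linear_combination 5 * (w : ZMod 13) * hk' + (w : ZMod 13) * k * h13
  · obtain ⟨k, hk⟩ : (3 : ℤ) ∣ a - b - c := by omega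
    refine .inr ⟨fun hr => h0 (hr.scale _), k, -1, .inr rfl, by omega, .of_scale hw13 ?_⟩
    have hk' : (a : ZMod 13) - b - c = 3 * k := by
      exact_mod_cast congrArg (Int.cast (R := ZMod 13)) hk
    push_cast
    convert h1 using 1
    · linear_combination 5 * (w : ZMod 13) * hk' + (w : ZMod 13) * k * h13
    · linear_combination -5 * (w : ZMod 13) * hk' - (w : ZMod 13) * k * h13
    · linear_combination -5 * (w : ZMod 13) * hk' - (w : ZMod 13) * k * h13

/-- A property of integer vectors that is invariant under signed permutations may be checked
modulo three on the vectors `(1, 1, 0)`. -/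
theorem normalize_mod_three {P : ℤ → ℤ → ℤ → Prop} (h₁ : ∀ a b c, P a b c → P b a c)
    (h₂ : ∀ a b c, P a b c → P a c b) (hneg : ∀ a b c, P a b c → P (-a) b c)
    (h : ∀ a b c, a % 3 = 1 → b % 3 = 1 → c % 3 = 0 → P a b c) {a b c : ℤ}
    (hs : (a ^ 2 + b ^ 2 + c ^ 2) % 3 = 2) : P a b c := by
  have hneg' : ∀ a b c, P a b c → P a (-b) c := fun a b c hP => h₁ _ _ _ (hneg _ _ _ (h₁ _ _ _ hP))
  have key : ∀ a b c, a % 3 ≠ 0 → b % 3 ≠ 0 → c % 3 = 0 → P a b c := by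
    have key' : ∀ a b c, a % 3 = 1 → b % 3 ≠ 0 → c % 3 = 0 → P a b c := by
      intro a b c ha hb hc
      rcases (by omega : b % 3 = 1 ∨ (-b) % 3 = 1) with hb | hb
      · exact h a b c ha hb hc
      · simpa using hneg' _ _ _ (h a (-b) c ha hb hc)
    intro a b c ha hb hc
    rcases (by omega : a % 3 = 1 ∨ (-a) % 3 = 1) with ha | ha
    · exact key' a b c ha hb hc
    · simpa using hneg _ _ _ (key' (-a) b c ha hb hc)
  have hcases : (a % 3 ≠ 0 ∧ b % 3 ≠ 0 ∧ c % 3 = 0) ∨ (a % 3 ≠ 0 ∧ b % 3 = 0 ∧ c % 3 ≠ 0) ∨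
      (a % 3 = 0 ∧ b % 3 ≠ 0 ∧ c % 3 ≠ 0) := by
    have sq : ∀ x : ℤ, (x % 3 = 0 ∧ x ^ 2 % 3 = 0) ∨ (x % 3 ≠ 0 ∧ x ^ 2 % 3 = 1) := by
      intro x
      rcases (by omega : x % 3 = 0 ∨ x % 3 = 1 ∨ x % 3 = 2) with hx | hx | hx <;>
        simp [pow_two, Int.mul_emod, hx]
    rcases sq a with ⟨ha, ha'⟩ | ⟨ha, ha'⟩ <;> rcases sq b with ⟨hb, hb'⟩ | ⟨hb, hb'⟩ <;>
      rcases sq c with ⟨hc, hc'⟩ | ⟨hc, hc'⟩ <;> omega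
  rcases hcases with ⟨ha, hb, hc⟩ | ⟨ha, hb, hc⟩ | ⟨ha, hb, hc⟩
  · exact key a b c ha hb hc
  · exact h₂ _ _ _ (key a c b ha hc hb)
  · exact h₁ _ _ _ (h₂ _ _ _ (key b c a hb hc ha))

/-- At most one reflection is needed: a failing triple reflects to one with `HasRoot`, and triples
with `HasRoot` never fail. `HasRoot` survives signed permutations, so the reflected triple can be
normalised modulo 3 again. -/
theorem exists_rep_one_two_three_five {e m a b c : ℤ} (he : e % 3 = 1)
    (h : 39 * m = e ^ 2 + a ^ 2 + b ^ 2 + c ^ 2) :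
    ∃ x y z t : ℤ, m = x ^ 2 + y ^ 2 + z ^ 2 + t ^ 2 ∧ x + 2 * y + 3 * z + 5 * t = e := by
  have he2 : e ^ 2 % 3 = 1 := by simp [pow_two, Int.mul_emod, he]
  have hroot : ∀ {a b c : ℤ}, 39 * m = e ^ 2 + a ^ 2 + b ^ 2 + c ^ 2 →
      HasRoot (e : ZMod 13) a b c →
      ∃ x y z t : ℤ, m = x ^ 2 + y ^ 2 + z ^ 2 + t ^ 2 ∧ x + 2 * y + 3 * z + 5 * t = e := by
    intro a b c h
    refine normalize_mod_three (P := fun a b c => 39 * m = e ^ 2 + a ^ 2 + b ^ 2 + c ^ 2 →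
      HasRoot (e : ZMod 13) a b c → _) ?_ ?_ ?_ ?_ (by omega) h
    · intro a b c hP h hr
      exact hP (by linear_combination h) (by unfold HasRoot at *; tauto)
    · intro a b c hP h hr
      exact hP (by linear_combination h) (by unfold HasRoot at *; tauto)
    · intro a b c hP h hr
      exact hP (by linear_combination h) (by simpa [HasRoot] using hr)
    · intro a b c ha hb hc h hr
      exact (exists_rep_of_mod_three he h ha hb hc).resolve_right fun h' => h'.1 hr
  refine normalize_mod_three (P := fun a b c => 39 * m = e ^ 2 + a ^ 2 + b ^ 2 + c ^ 2 → _)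
    ?_ ?_ ?_ ?_ (by omega) h
  · exact fun a b c hP h => hP (by linear_combination h)
  · exact fun a b c hP h => hP (by linear_combination h)
  · exact fun a b c hP h => hP (by linear_combination h)
  · intro a b c ha hb hc h
    rcases exists_rep_of_mod_three he h ha hb hc with h' | ⟨-, k, l, hl, hk, hr⟩
    · exact h'
    · have hl2 : l ^ 2 = 1 := by rcases hl with rfl | rfl <;> norm_num
      exact hroot (by linear_combination h - 4 * k * hk - 4 * k ^ 2 * hl2) hr

/-! ### Choice of n and nonnegativity -/

theorem sum_three_squares_of_mod_sixteen {n : ℤ} (h0 : 0 ≤ n)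
    (h : (n % 4 ≠ 0 ∧ n % 8 ≠ 7) ∨ n % 16 = 8) : ∃ x y z : ℤ, n = x ^ 2 + y ^ 2 + z ^ 2 := by
  rcases h with ⟨h4, h8⟩ | h
  · exact sum_three_squares h0 h4 h8
  · obtain ⟨k, rfl⟩ : (4 : ℤ) ∣ n := by omega
    obtain ⟨x, y, z, hk⟩ := sum_three_squares (n := k) (by omega) (by omega) (by omega)
    exact ⟨2 * x, 2 * y, 2 * z, by rw [hk]; ring⟩

theorem pow_four_mod_sixteen (n : ℕ) :
    (n % 2 = 0 → n ^ 4 % 16 = 0) ∧ (n % 2 = 1 → n ^ 4 % 16 = 1) := by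
  have : ∀ r < 16, (r % 2 = 0 → r ^ 4 % 16 = 0) ∧ (r % 2 = 1 → r ^ 4 % 16 = 1) := by decide
  have h := this (n % 16) (Nat.mod_lt _ (by norm_num))
  rw [Nat.pow_mod]
  rwa [Nat.mod_mod_of_dvd _ (by norm_num)] at h

theorem pow_four_mod_three (n : ℕ) :
    (n % 3 = 0 → n ^ 4 % 3 = 0) ∧ (n % 3 ≠ 0 → n ^ 4 % 3 = 1) := by
  have : ∀ r < 3, (r = 0 → r ^ 4 % 3 = 0) ∧ (r ≠ 0 → r ^ 4 % 3 = 1) := by decide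
  rw [Nat.pow_mod]
  exact this (n % 3) (Nat.mod_lt _ (by norm_num))

theorem exists_pow_four_lt_le {M : ℕ} (hM : 0 < M) : ∃ j : ℕ, j ^ 4 < M ∧ M ≤ (j + 1) ^ 4 := by
  have hex : ∃ j : ℕ, M ≤ (j + 1) ^ 4 :=
    ⟨M, by nlinarith [Nat.le_self_pow (n := 4) (by norm_num) (M + 1)]⟩
  refine ⟨Nat.find hex, ?_, Nat.find_spec hex⟩
  rcases hj : Nat.find hex with _ | j
  · simpa using hM
  · exact not_le.1 (Nat.find_min hex (by omega : j < Nat.find hex))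

/-- Four consecutive candidates allow a prescribed parity together with 3 ∤ n. -/
theorem window_thirty_eight {m : ℕ} (hm : 3740000000 ≤ m) :
    ∃ k : ℕ, 38 * m ≤ k ^ 4 ∧ (k + 3) ^ 4 ≤ 39 * m := by
  obtain ⟨j, hj, hj'⟩ := exists_pow_four_lt_le (by omega : 0 < 38 * m)
  refine ⟨j + 1, hj', ?_⟩
  -- 614 is the least j with 38(j + 4)⁴ ≤ 39j⁴.
  rcases Nat.lt_or_ge j 614 with h | h
  · have : (j + 1 + 3) ^ 4 ≤ 617 ^ 4 := Nat.pow_le_pow_left (by omega) 4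
    omega
  · obtain ⟨i, rfl⟩ := Nat.exists_eq_add_of_le h
    have : 38 * (614 + i + 1 + 3) ^ 4 ≤ 39 * (614 + i) ^ 4 := by
      ring_nf
      nlinarith [Nat.zero_le (i ^ 4), Nat.zero_le (i ^ 3), Nat.zero_le (i ^ 2)]
    omega

/-- Twelve consecutive candidates contain two in each class modulo 6, differing by 6, so one of them
avoids 29. -/
theorem window_twenty_five {m : ℕ} (hm : 7670000000 ≤ m) :
    ∃ k : ℕ, 25 * m ≤ k ^ 4 ∧ (k + 11) ^ 4 ≤ 29 * m := by
  obtain ⟨j, hj, hj'⟩ := exists_pow_four_lt_le (by omega : 0 < 25 * m)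
  refine ⟨j + 1, hj', ?_⟩
  rcases Nat.lt_or_ge j 600 with h | h
  · have : (j + 1 + 11) ^ 4 ≤ 611 ^ 4 := Nat.pow_le_pow_left (by omega) 4
    omega
  · obtain ⟨i, rfl⟩ := Nat.exists_eq_add_of_le h
    have : 25 * (600 + i + 1 + 11) ^ 4 ≤ 29 * (600 + i) ^ 4 := by
      ring_nf
      nlinarith [Nat.zero_le (i ^ 4), Nat.zero_le (i ^ 3), Nat.zero_le (i ^ 2)]
    omega

/-- If x < 0 then 0 ≤ px + r < r, so its square would be below r² ≤ M. -/
theorem nonneg_of_sq_le {p x r M : ℤ} (hp : 0 < p) (hr : r ^ 2 ≤ M) (h0 : 0 ≤ p * x + r)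
    (hM : M ≤ (p * x + r) ^ 2) : 0 ≤ x := by
  by_contra h
  have hpx : p * x < 0 := mul_neg_of_pos_of_neg hp (not_le.1 h)
  have : (p * x + r) ^ 2 < r ^ 2 := pow_lt_pow_left₀ (by linarith) h0 (by norm_num)
  linarith

theorem isRestrictedSum_one_two_three_five {m : ℕ} (hm : 3740000000 ≤ m) (h16 : ¬ 16 ∣ m) :
    IsRestrictedSum 1 2 3 5 m := by
  obtain ⟨k, hk, hk'⟩ := window_thirty_eight hm
  -- The parity makes 39m - n⁴ a sum of three squares; 16 ∤ m is needed when 8 ∣ m, where n is even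
  -- and 39m - n⁴ ≡ 8 mod 16.
  obtain ⟨n, hkn, hnk, hn3, hn2⟩ : ∃ n, k ≤ n ∧ n ≤ k + 3 ∧ n % 3 ≠ 0 ∧
      (n % 2 = 0 ↔ m % 8 = 0 ∨ m % 8 = 3 ∨ m % 8 = 5 ∨ m % 8 = 7) := by
    by_cases h : m % 8 = 0 ∨ m % 8 = 3 ∨ m % 8 = 5 ∨ m % 8 = 7
    · simp only [h, iff_true]
      by_cases h0 : (k + k % 2) % 3 = 0
      exacts [⟨k + k % 2 + 2, by omega⟩, ⟨k + k % 2, by omega⟩]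
    · simp only [h, iff_false]
      by_cases h0 : (k + (k + 1) % 2) % 3 = 0
      exacts [⟨k + (k + 1) % 2 + 2, by omega⟩, ⟨k + (k + 1) % 2, by omega⟩]
  have hlo : 38 * m ≤ n ^ 4 := hk.trans (Nat.pow_le_pow_left hkn 4)
  have hhi : n ^ 4 ≤ 39 * m := (Nat.pow_le_pow_left hnk 4).trans hk'
  have h4 := pow_four_mod_sixteen n
  have h43 : n ^ 2 % 3 = 1 := by
    rcases (by omega : n % 3 = 1 ∨ n % 3 = 2) with h | h <;> simp [Nat.pow_mod, h]
  have hcast : (n : ℤ) ^ 4 = ((n ^ 4 : ℕ) : ℤ) := by push_cast; rfl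
  obtain ⟨a, b, c, habc⟩ := sum_three_squares_of_mod_sixteen (n := 39 * m - n ^ 4)
    (by rw [hcast]; omega) (by rw [hcast]; omega)
  obtain ⟨x, y, z, t, hm', hs⟩ := exists_rep_one_two_three_five (e := (n : ℤ) ^ 2) (m := m)
    (a := a) (b := b) (c := c) (by exact_mod_cast h43) (by linear_combination habc)
  have hlo' : 38 * (m : ℤ) ≤ (x + 2 * y + 3 * z + 5 * t) ^ 2 := by
    rw [hs, ← pow_mul, hcast]; exact_mod_cast hlo
  have hs0 : 0 ≤ x + 2 * y + 3 * z + 5 * t := by rw [hs]; positivity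
  have hx : 0 ≤ x := by
    refine nonneg_of_sq_le (p := 1) (r := 2 * y + 3 * z + 5 * t) (by norm_num) ?_ (by linarith)
      (by convert hlo' using 2; ring)
    -- Lagrange's identity behind Cauchy–Schwarz, with 38 = 2² + 3² + 5².
    linarith [sq_nonneg (3 * y - 2 * z), sq_nonneg (5 * y - 2 * t), sq_nonneg (5 * z - 3 * t),
      sq_nonneg x]
  have hy : 0 ≤ y := by
    refine nonneg_of_sq_le (p := 2) (r := x + 3 * z + 5 * t) (by norm_num) ?_ (by linarith)
      (by convert hlo' using 2; ring)
    linarith [sq_nonneg (3 * x - z), sq_nonneg (5 * x - t), sq_nonneg (5 * z - 3 * t),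
      sq_nonneg x, sq_nonneg y, sq_nonneg z, sq_nonneg t]
  have hz : 0 ≤ z := by
    refine nonneg_of_sq_le (p := 3) (r := x + 2 * y + 5 * t) (by norm_num) ?_ (by linarith)
      (by convert hlo' using 2; ring)
    linarith [sq_nonneg (2 * x - y), sq_nonneg (5 * x - t), sq_nonneg (5 * y - 2 * t),
      sq_nonneg x, sq_nonneg y, sq_nonneg z, sq_nonneg t]
  have ht : 0 ≤ t := by
    refine nonneg_of_sq_le (p := 5) (r := x + 2 * y + 3 * z) (by norm_num) ?_ (by linarith)
      (by convert hlo' using 2; ring)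
    linarith [sq_nonneg (2 * x - y), sq_nonneg (3 * x - z), sq_nonneg (3 * y - 2 * z),
      sq_nonneg x, sq_nonneg y, sq_nonneg z, sq_nonneg t]
  lift x to ℕ using hx
  lift y to ℕ using hy
  lift z to ℕ using hz
  lift t to ℕ using ht
  refine ⟨x, y, z, t, by exact_mod_cast hm', n, ?_⟩
  zify
  linear_combination hs

theorem exists_mod_six_eq (k : ℕ) {r : ℕ} (hr : r < 6) :
    ∃ n, k ≤ n ∧ n ≤ k + 11 ∧ ¬ 29 ∣ n ∧ n % 6 = r := by
  obtain ⟨n, h1, h2, h3⟩ : ∃ n, k ≤ n ∧ n ≤ k + 5 ∧ n % 6 = r :=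
    ⟨k + (r + 6 - k % 6) % 6, by omega⟩
  by_cases h29 : 29 ∣ n
  · exact ⟨n + 6, by omega⟩
  · exact ⟨n, by omega⟩

theorem isRestrictedSum_two_three_four {m : ℕ} (hm : 7670000000 ≤ m) (h16 : ¬ 16 ∣ m) :
    IsRestrictedSum 2 3 4 0 m := by
  obtain ⟨k, hk, hk'⟩ := window_twenty_five hm
  -- The condition modulo 3 gives 29m - n⁴ ≢ 1 mod 3, so an integral reflection exists; the parity
  -- serves the three-square theorem.
  obtain ⟨n, hkn, hnk, hn29, hn3, hn2⟩ : ∃ n, k ≤ n ∧ n ≤ k + 11 ∧ ¬ 29 ∣ n ∧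
      (n % 3 = 0 ↔ m % 3 = 1) ∧
      (n % 2 = 0 ↔ m % 8 = 0 ∨ m % 8 = 1 ∨ m % 8 = 5 ∨ m % 8 = 7) := by
    obtain ⟨r, hr, hr3, hr2⟩ : ∃ r < 6, (r % 3 = 0 ↔ m % 3 = 1) ∧
        (r % 2 = 0 ↔ m % 8 = 0 ∨ m % 8 = 1 ∨ m % 8 = 5 ∨ m % 8 = 7) := by
      by_cases h : m % 8 = 0 ∨ m % 8 = 1 ∨ m % 8 = 5 ∨ m % 8 = 7 <;> by_cases h' : m % 3 = 1 <;>
        simp only [h, h', iff_true, iff_false]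
      exacts [⟨0, by decide⟩, ⟨2, by decide⟩, ⟨3, by decide⟩, ⟨1, by decide⟩]
    obtain ⟨n, h1, h2, h29, h6⟩ := exists_mod_six_eq k hr
    refine ⟨n, h1, h2, h29, ?_, ?_⟩
    · rw [← hr3, ← h6]; omega
    · rw [← hr2, ← h6]; omega
  have hlo : 25 * m ≤ n ^ 4 := hk.trans (Nat.pow_le_pow_left hkn 4)
  have hhi : n ^ 4 ≤ 29 * m := (Nat.pow_le_pow_left hnk 4).trans hk'
  have hcast : (n : ℤ) ^ 4 = ((n ^ 4 : ℕ) : ℤ) := by push_cast; rfl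
  have h16' : ((29 * m - n ^ 4 : ℤ) % 4 ≠ 0 ∧ (29 * m - n ^ 4 : ℤ) % 8 ≠ 7) ∨
      (29 * m - n ^ 4 : ℤ) % 16 = 8 := by
    rw [hcast]
    have h4 := pow_four_mod_sixteen n
    generalize n ^ 4 = q at *
    clear hcast hlo hhi hk hk' hm hkn hnk hn3 hn29
    rcases Nat.mod_two_eq_zero_or_one n with h | h
    · have h4 := h4.1 h
      rcases hn2.1 h with h | h | h | h <;> omega
    · have h4 := h4.2 h
      have : ¬ (m % 8 = 0 ∨ m % 8 = 1 ∨ m % 8 = 5 ∨ m % 8 = 7) := by rw [← hn2]; omega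
      omega
  obtain ⟨a, b, c, habc⟩ := sum_three_squares_of_mod_sixteen (n := 29 * m - n ^ 4)
    (by rw [hcast]; omega) h16'
  have h3 : (29 * m - n ^ 4 : ℤ) % 3 ≠ 1 := by
    rw [hcast]
    have h43 := pow_four_mod_three n
    by_cases h : n % 3 = 0
    · have := h43.1 h
      have := hn3.1 h
      omega
    · have := h43.2 h
      have := mt hn3.2 h
      omega
  have h29 : ¬ (29 : ℤ) ∣ (n : ℤ) ^ 2 := fun h =>
    hn29 (by exact_mod_cast (Int.prime_ofNat_iff.2 (by norm_num : Nat.Prime 29)).dvd_of_dvd_pow h)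
  obtain ⟨x, y, z, t, hm', hs⟩ := exists_rep_two_three_four (e := (n : ℤ) ^ 2) (m := m)
    (a := a) (b := b) (c := c) h29 (by linear_combination habc)
    (by rw [← habc]; exact h3)
  have hlo' : 25 * (m : ℤ) ≤ (2 * x + 3 * y + 4 * z) ^ 2 := by
    rw [hs, ← pow_mul, hcast]; exact_mod_cast hlo
  have hs0 : 0 ≤ 2 * x + 3 * y + 4 * z := by rw [hs]; positivity
  have hx : 0 ≤ x := by
    refine nonneg_of_sq_le (p := 2) (r := 3 * y + 4 * z) (by norm_num) ?_ (by linarith)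
      (by convert hlo' using 2; ring)
    linarith [sq_nonneg (4 * y - 3 * z), sq_nonneg t, sq_nonneg x]
  have hy : 0 ≤ y := by
    refine nonneg_of_sq_le (p := 3) (r := 2 * x + 4 * z) (by norm_num) ?_ (by linarith)
      (by convert hlo' using 2; ring)
    linarith [sq_nonneg (4 * x - 2 * z), sq_nonneg t, sq_nonneg x, sq_nonneg y, sq_nonneg z]
  have hz : 0 ≤ z := by
    refine nonneg_of_sq_le (p := 4) (r := 2 * x + 3 * y) (by norm_num) ?_ (by linarith)
      (by convert hlo' using 2; ring)
    linarith [sq_nonneg (3 * x - 2 * y), sq_nonneg t, sq_nonneg x, sq_nonneg y, sq_nonneg z]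
  lift x to ℕ using hx
  lift y to ℕ using hy
  lift z to ℕ using hz
  refine ⟨x, y, z, t.natAbs, ?_, n, ?_⟩
  · zify
    rw [sq_abs]
    exact hm'
  · zify
    linear_combination hs

/-! ### Descent by factors of sixteen -/

theorem IsRestrictedSum.sixteen_mul {a b c d m : ℕ} (h : IsRestrictedSum a b c d m) :
    IsRestrictedSum a b c d (16 * m) := by
  obtain ⟨x, y, z, t, hm, n, hn⟩ := h
  refine ⟨4 * x, 4 * y, 4 * z, 4 * t, by rw [hm]; ring, 2 * n, ?_⟩
  linear_combination 4 * hn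

/-- Descent by factors of sixteen from a bound `M` valid for integers not divisible by sixteen. -/
theorem isRestrictedSum_of_finite_check {a b c d M : ℕ} {f : ℕ → ℕ}
    (hf : ∀ k, 16 * f k = f (k + 1))
    (hM : ∀ m, M ≤ m → ¬ 16 ∣ m → IsRestrictedSum a b c d m)
    (hfin : ∀ m, 0 < m → m < M → (∀ k, m ≠ f k) → IsRestrictedSum a b c d m) (m : ℕ)
    (hm : ∀ k, m ≠ f k) : IsRestrictedSum a b c d m := by
  induction m using Nat.strong_induction_on with
  | _ m ih =>
  rcases Nat.eq_zero_or_pos m with rfl | h0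
  · exact ⟨0, 0, 0, 0, rfl, 0, rfl⟩
  by_cases h16 : 16 ∣ m
  · obtain ⟨l, rfl⟩ := h16
    -- If l were exceptional, so would be 16l, since `f` is multiplied by 16 at each step.
    exact (ih l (by omega) fun k hk => hm (k + 1) (by rw [hk, hf])).sixteen_mul
  · rcases Nat.lt_or_ge m M with h | h
    exacts [hfin m h0 h hm, hM m h h16]

theorem theorem1p4 :
    (∀ m : ℕ, 3740000000 ≤ m → ¬ 16 ∣ m → IsRestrictedSum 1 2 3 5 m) ∧
    (∀ m : ℕ, 7670000000 ≤ m → ¬ 16 ∣ m → IsRestrictedSum 2 3 4 0 m) ∧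
    ((∀ m : ℕ, 0 < m → m < 3740000000 → (∀ k : ℕ, m ≠ 7 * 4 ^ (2 * k + 1)) →
        IsRestrictedSum 1 2 3 5 m) →
      ∀ m : ℕ, (∀ k : ℕ, m ≠ 7 * 4 ^ (2 * k + 1)) → IsRestrictedSum 1 2 3 5 m) ∧
    ((∀ m : ℕ, 0 < m → m < 7670000000 → (∀ k : ℕ, m ≠ 3 * 2 ^ (4 * k + 1)) →
        IsRestrictedSum 2 3 4 0 m) →
      ∀ m : ℕ, (∀ k : ℕ, m ≠ 3 * 2 ^ (4 * k + 1)) → IsRestrictedSum 2 3 4 0 m) :=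
  ⟨fun _ => isRestrictedSum_one_two_three_five, fun _ => isRestrictedSum_two_three_four,
    isRestrictedSum_of_finite_check (fun k => by ring)
      fun _ => isRestrictedSum_one_two_three_five,
    isRestrictedSum_of_finite_check (fun k => by ring)
      fun _ => isRestrictedSum_two_three_four⟩
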